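/- Let $c_i=\frac{1}{i+1}\binom{2i}{i}$ denote the $i$-th Catalan number. Represent a set partition of $[n]=\{1,\dots,n\}$, whose blocks $B_1,B_2,\dots$ are arranged in increasing order of smallest elements, by its canonical word (restricted growth sequence) $\pi=\pi_1\pi_2\cdots\pi_n$, where $i\in B_{\pi_i}$ for each $i$. The partition is called non-crossing if this word has no subsequence of the form $abab$ with $a<b$. The successor of the letter $\pi_i$ is $\pi_{i+1}$ if $i<n$, and the successor of the last letter $\pi_n$ is the first letter $\pi_1$ (so for $n=1$ the single letter is its own successor). (a) For every $n\ge 0$, the number of non-crossing partitions of $[n]$ whose canonical word contains no two equal adjacent letters, where the first and last letters are considered adjacent (that is, no letter equals its successor), is $$K_n=\sum_{i=0}^n(-1)^{n-i}\binom{n}{i}c_i .$$ (b) For all $0\le j\le n$, the number of non-crossing partitions of $[n]$ in whose canonical word none of the letters $\pi_1,\dots,\pi_j$ equals its successor is $$\sum_{i=0}^j(-1)^i\binom{j}{i}c_{n-i}.$$ -/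

import Mathlib

open Finset

/-- Set partitions of `[n]` are elements of `Finpartition (univ : Finset (Fin n))`; the element
`k` of `[n] = {1, …, n}` is `k - 1 : Fin n`.

`canonicalWord P` is the canonical form `π₁ π₂ ⋯ πₙ` of `P`: if the blocks `B₁, B₂, …` of `P` are
arranged in increasing order of smallest elements, then the `i`-th letter is the index
(starting with `1`) of the block that contains `i`, that is, the number of blocks whose
smallest element is at most that of the block of `i`. -/
def canonicalWord {n : ℕ} (P : Finpartition (univ : Finset (Fin n))) (i : Fin n) : ℕ :=
  #{B ∈ P.parts | B.min ≤ (P.part i).min}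

/-- The word `w` has a subsequence `a b a b` with `a < b`. -/
def Contains1212 {n : ℕ} (w : Fin n → ℕ) : Prop :=
  ∃ i j k l : Fin n, i < j ∧ j < k ∧ k < l ∧ w i < w j ∧ w k = w i ∧ w l = w j

/-- A set partition is non-crossing if its canonical form avoids the pattern `1212`. -/
def IsNonCrossing {n : ℕ} (P : Finpartition (univ : Finset (Fin n))) : Prop :=
  ¬ Contains1212 (canonicalWord P)

/-- No two cyclically adjacent letters of `w` are equal: `finRotate n` sends each position to the
next one and the last position to the first one. -/
def NoEqualCyclicallyAdjacent {n : ℕ} (w : Fin n → ℕ) : Prop :=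
  ∀ i : Fin n, w i ≠ w (finRotate n i)

/-- None of the letters in the first `j` positions equals its successor; the successor of the last
letter (this only matters if `j = n`) is the first one. -/
def NoEqualSuccessorAmongFirst {n : ℕ} (j : ℕ) (w : Fin n → ℕ) : Prop :=
  ∀ i : Fin n, (i : ℕ) < j → w i ≠ w (finRotate n i)

/-- The number `K_n = ∑_{i=0}^n (-1)^{n-i} C(n,i) c_i`, with `c_i` the Catalan numbers. -/
def catalanDifference (n : ℕ) : ℤ :=
  ∑ i ∈ range (n + 1), (-1 : ℤ) ^ (n - i) * (n.choose i : ℤ) * (catalan i : ℤ)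

/-!
A partition is determined by its equivalence relation on the positions, two positions being related
when their letters are equal. Suppose that a position `q` is related to its cyclic successor.
Merging the two is then a bijection onto the non-crossing relations on one position fewer, and it
keeps the successors of the positions before `q`. Hence the number `A n j` of non-crossing
relations on `n` positions without a related successor among the first `j` satisfies
`A (n + 1) (j + 1) = A (n + 1) j - A n j`, so that `A (m + j) j` is the `j`-th forward difference
of `A · 0` at `m`, and both formulas are its binomial expansion.

That `A n 0` is the Catalan number follows by cutting before the least position `i` related to the
last one: nothing before `i` is related to anything from `i` on, and in the second part the last
position and its cyclic successor `i` can be merged, which gives the Catalan recursion.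
-/

/-- An equivalence relation on an ordered type is non-crossing if any two of its classes that
interleave coincide. The encoding by `Setoid` lets partitions be pulled back along maps. -/
def NonCrossing {α : Type*} [LT α] (r : Setoid α) : Prop :=
  ∀ ⦃i j k l : α⦄, i < j → j < k → k < l → r i k → r j l → r i j

namespace NonCrossing

variable {α β γ : Type*}

theorem comap_monotone [Preorder α] [PartialOrder β] {r : Setoid β} (hr : NonCrossing r)
    {f : α → β} (hf : Monotone f) : NonCrossing (r.comap f) := by
  intro i j k l hij hjk hkl hik hjl
  simp only [Setoid.comap_rel] at *
  rcases (hf hij.le).eq_or_lt with h | hij'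
  · rw [h]
  rcases (hf hjk.le).eq_or_lt with h | hjk'
  · rwa [h]
  rcases (hf hkl.le).eq_or_lt with h | hkl'
  · exact r.trans hik (r.symm (h ▸ hjl))
  exact hr hij' hjk' hkl' hik hjl

theorem of_rel_bot_top [PartialOrder α] [BoundedOrder α] {r : Setoid α} (hr : r ⊥ ⊤)
    (h : NonCrossing (r.comap ((↑) : Set.Iio (⊤ : α) → α))) : NonCrossing r := by
  intro i j k l hij hjk hkl hik hjl
  have hk : k < ⊤ := hkl.trans_le le_top
  have hj : j < ⊤ := hjk.trans hk
  have hi : i < ⊤ := hij.trans hj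
  rcases (le_top : l ≤ ⊤).eq_or_lt with rfl | hl
  · have hbj : r ⊥ j := r.trans hr (r.symm hjl)
    rcases (bot_le : ⊥ ≤ i).eq_or_lt with rfl | hbi
    · exact hbj
    have hbot : (⊥ : α) < ⊤ := hbi.trans hi
    have hbi' : r ⊥ i := @h ⟨⊥, hbot⟩ ⟨i, hi⟩ ⟨j, hj⟩ ⟨k, hk⟩ hbi hij hjk hbj hik
    exact r.trans (r.symm hbi') hbj
  · exact @h ⟨i, hi⟩ ⟨j, hj⟩ ⟨k, hk⟩ ⟨l, hl⟩ hij hjk hkl hik hjl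

theorem of_comap_of_forall_lt [Preorder α] [Preorder β] [Preorder γ] {r : Setoid α}
    {f : β ↪o α} {g : γ ↪o α} (hfg : ∀ b c, f b < g c)
    (hcover : ∀ a, a ∈ Set.range f ∨ a ∈ Set.range g) (hr : ∀ b c, ¬ r (f b) (g c))
    (hrf : NonCrossing (r.comap f)) (hrg : NonCrossing (r.comap g)) : NonCrossing r := by
  have below (a : α) (b : β) (h : a < f b) : a ∈ Set.range f :=
    (hcover a).resolve_right fun ⟨c, hc⟩ => lt_asymm h (hc ▸ hfg b c)
  have above (a : α) (c : γ) (h : g c < a) : a ∈ Set.range g :=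
    (hcover a).resolve_left fun ⟨b, hb⟩ => lt_asymm h (hb ▸ hfg b c)
  intro i j k l hij hjk hkl hik hjl
  rcases hcover l with ⟨l, rfl⟩ | ⟨l, rfl⟩
  · obtain ⟨k, rfl⟩ := below k l hkl
    obtain ⟨j, rfl⟩ := below j k hjk
    obtain ⟨i, rfl⟩ := below i j hij
    exact hrf (f.lt_iff_lt.1 hij) (f.lt_iff_lt.1 hjk) (f.lt_iff_lt.1 hkl) hik hjl
  · obtain ⟨j, rfl⟩ := (hcover j).resolve_left fun ⟨b, hb⟩ => hr b l (hb ▸ hjl)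
    obtain ⟨k, rfl⟩ := above k j hjk
    obtain ⟨i, rfl⟩ := (hcover i).resolve_left fun ⟨b, hb⟩ => hr b k (hb ▸ hik)
    exact hrg (g.lt_iff_lt.1 hij) (g.lt_iff_lt.1 hjk) (g.lt_iff_lt.1 hkl) hik hjl

end NonCrossing

section CanonicalWord

theorem ker_part_bijective (α : Type*) [Fintype α] [DecidableEq α] :
    Function.Bijective fun P : Finpartition (univ : Finset α) => Setoid.ker P.part := by
  classical
  have mem_part {P : Finpartition (univ : Finset α)} {a b : α} :
      b ∈ P.part a ↔ Setoid.ker P.part b a :=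
    P.mem_part_iff_part_eq_part (mem_univ b) (mem_univ a)
  refine ⟨fun P Q h => ?_, fun r => ⟨Finpartition.ofSetoid r, ?_⟩⟩
  · have part_eq : P.part = Q.part := by
      ext a b
      rw [mem_part, mem_part]
      exact Setoid.ext_iff.1 h b a
    have mem_parts (R : Finpartition (univ : Finset α)) (B : Finset α) :
        B ∈ R.parts ↔ ∃ a, R.part a = B :=
      ⟨fun hB => (R.part_surjOn hB).imp fun _ => And.right,
        fun ⟨a, ha⟩ => ha ▸ R.part_mem.2 (mem_univ a)⟩
    ext B
    rw [mem_parts, mem_parts, part_eq]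
  · ext a b
    rw [← mem_part, Finpartition.mem_part_ofSetoid_iff_rel, Setoid.comm']

variable {n : ℕ} (P : Finpartition (univ : Finset (Fin n)))

theorem canonicalWord_le_iff {i j : Fin n} :
    canonicalWord P i ≤ canonicalWord P j ↔ (P.part i).min ≤ (P.part j).min := by
  refine ⟨fun h => ?_, fun h => card_le_card (monotone_filter_right _ fun B _ hB => hB.trans h)⟩
  contrapose! h
  refine card_lt_card ((ssubset_iff_of_subset ?_).2 ⟨P.part i, ?_, ?_⟩)
  · exact monotone_filter_right _ fun B _ hB => hB.trans h.le
  · exact mem_filter.2 ⟨P.part_mem.2 (mem_univ i), le_rfl⟩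
  · exact fun hi => (mem_filter.1 hi).2.not_gt h

theorem canonicalWord_eq_iff {i j : Fin n} :
    canonicalWord P i = canonicalWord P j ↔ P.part i = P.part j := by
  rw [le_antisymm_iff, canonicalWord_le_iff, canonicalWord_le_iff, ← le_antisymm_iff]
  refine ⟨fun h => ?_, congrArg Finset.min⟩
  obtain ⟨a, ha⟩ := min_of_mem (P.mem_part (mem_univ i))
  exact P.eq_of_mem_parts (P.part_mem.2 (mem_univ i)) (P.part_mem.2 (mem_univ j))
    (mem_of_min ha) (mem_of_min (h ▸ ha))

theorem exists_lt_canonicalWord_eq {i j : Fin n} (h : canonicalWord P j < canonicalWord P i) :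
    ∃ p < i, canonicalWord P p = canonicalWord P j := by
  rw [← not_le, canonicalWord_le_iff, not_le] at h
  obtain ⟨p, hp⟩ := min_of_mem (P.mem_part (mem_univ j))
  refine ⟨p, ?_, ?_⟩
  · exact WithTop.coe_lt_coe.1 (hp ▸ h.trans_le (min_le (P.mem_part (mem_univ i))))
  · rw [canonicalWord_eq_iff, ← P.mem_part_iff_part_eq_part (mem_univ _) (mem_univ _)]
    exact mem_of_min hp

theorem isNonCrossing_iff_nonCrossing_ker_part :
    IsNonCrossing P ↔ NonCrossing (Setoid.ker P.part) := by
  simp only [NonCrossing, Setoid.ker_def, ← canonicalWord_eq_iff]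
  constructor
  · intro h i j k l hij hjk hkl hik hjl
    rcases lt_trichotomy (canonicalWord P i) (canonicalWord P j) with hw | hw | hw
    · exact (h ⟨i, j, k, l, hij, hjk, hkl, hw, hik.symm, hjl.symm⟩).elim
    · exact hw
    · -- The letter of `j` also occurs before `i`, which exposes `1212` at `p < i < j < k`.
      obtain ⟨p, hpi, hpj⟩ := exists_lt_canonicalWord_eq P hw
      exact (h ⟨p, i, j, k, hpi, hij, hjk, hpj ▸ hw, hpj.symm, hik.symm⟩).elim
  · rintro h ⟨i, j, k, l, hij, hjk, hkl, hw, hki, hlj⟩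
    exact hw.ne (h hij hjk hkl hki.symm hlj.symm)

end CanonicalWord

/-- No position among the first `j` is related to its cyclic successor. -/
def NoRelSuccessor {n : ℕ} (j : ℕ) (r : Setoid (Fin n)) : Prop :=
  ∀ i : Fin n, (i : ℕ) < j → ¬ r i (finRotate n i)

theorem noRelSuccessor_zero {n : ℕ} (r : Setoid (Fin n)) : NoRelSuccessor 0 r :=
  fun _ h => absurd h (Nat.not_lt_zero _)

theorem noRelSuccessor_succ {n : ℕ} (q : Fin n) (r : Setoid (Fin n)) :
    NoRelSuccessor (q + 1) r ↔ NoRelSuccessor q r ∧ ¬ r q (finRotate n q) := by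
  simp only [NoRelSuccessor, Nat.lt_succ_iff_lt_or_eq, or_imp, forall_and, ← Fin.ext_iff,
    forall_eq]

/-- The number of non-crossing equivalence relations on `Fin n` in which no position among the
first `j` is related to its cyclic successor. -/
noncomputable def nonCrossingCount (n j : ℕ) : ℕ :=
  {r : Setoid (Fin n) | NonCrossing r ∧ NoRelSuccessor j r}.ncard

theorem ncard_nonCrossing (n : ℕ) :
    {r : Setoid (Fin n) | NonCrossing r}.ncard = nonCrossingCount n 0 := by
  simp only [nonCrossingCount, noRelSuccessor_zero, and_true]

theorem card_isNonCrossing_noEqualSuccessorAmongFirst (n j : ℕ) :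
    Nat.card {P : Finpartition (univ : Finset (Fin n)) //
      IsNonCrossing P ∧ NoEqualSuccessorAmongFirst j (canonicalWord P)} =
      nonCrossingCount n j := by
  rw [nonCrossingCount, ← Nat.card_coe_set_eq]
  refine Nat.card_congr
    ((Equiv.ofBijective _ (ker_part_bijective (Fin n))).subtypeEquiv fun P => ?_)
  refine and_congr (isNonCrossing_iff_nonCrossing_ker_part P) ?_
  exact forall₂_congr fun i _ => not_congr (canonicalWord_eq_iff P)

instance finite_setoid (α : Type*) [Finite α] : Finite (Setoid α) :=
  Finite.of_injective (fun r : Setoid α => ⇑r) fun _ _ => Setoid.eq_iff_rel_eq.2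

section MergeSuccessor

variable {n : ℕ}

/-- The map that identifies the position `q` with its cyclic successor and renumbers the resulting
`n + 1` positions in order. For the last position, `Fin.ofNat` wraps `n + 1` around to `0`. -/
def mergeSuccessor (q x : Fin (n + 2)) : Fin (n + 1) :=
  Fin.ofNat (n + 1) (if x ≤ q then (x : ℕ) else x - 1)

theorem mergeSuccessor_succAbove (q : Fin (n + 2)) (x : Fin (n + 1)) :
    mergeSuccessor q (q.succAbove x) = x := by
  rcases lt_or_ge x.castSucc q with h | h
  · simp [mergeSuccessor, Fin.succAbove_of_castSucc_lt _ _ h, h.le]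
  · simp [mergeSuccessor, Fin.succAbove_of_le_castSucc _ _ h,
      (Fin.le_castSucc_iff.1 h).not_ge]

theorem mergeSuccessor_self_finRotate (q : Fin (n + 2)) :
    mergeSuccessor q (finRotate (n + 2) q) = mergeSuccessor q q := by
  induction q using Fin.lastCases with
  | last => simp [mergeSuccessor]
  | cast q => simp [mergeSuccessor, Fin.coeSucc_eq_succ]

theorem val_mergeSuccessor_of_lt {q x : Fin (n + 2)} (hx : x < q) :
    (mergeSuccessor q x : ℕ) = x := by
  rw [mergeSuccessor, if_pos hx.le, Fin.val_ofNat, Nat.mod_eq_of_lt (by lia)]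

theorem mergeSuccessor_finRotate_of_lt {q x : Fin (n + 2)} (hx : x < q) :
    mergeSuccessor q (finRotate (n + 2) x) = finRotate (n + 1) (mergeSuccessor q x) := by
  have hval : (finRotate (n + 2) x : ℕ) = x + 1 := coe_finRotate_of_ne_last (Fin.ne_last_of_lt hx)
  have hle : finRotate (n + 2) x ≤ q := by rw [Fin.le_def, hval]; exact hx
  rw [mergeSuccessor, mergeSuccessor, if_pos hle, if_pos hx.le, hval, finRotate_apply]
  ext
  simp [Fin.val_add]

theorem monotone_mergeSuccessor_castSucc (q : Fin (n + 1)) :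
    Monotone (mergeSuccessor q.castSucc) := by
  have hval (x : Fin (n + 2)) :
      (mergeSuccessor q.castSucc x : ℕ) = if x ≤ q.castSucc then (x : ℕ) else x - 1 := by
    rw [mergeSuccessor, Fin.val_ofNat, Nat.mod_eq_of_lt]
    split_ifs with hx
    · exact (Fin.le_def.1 hx).trans_lt q.isLt
    · lia
  intro x y hxy
  rw [Fin.le_def, hval, hval]
  split_ifs <;> lia

theorem nonCrossing_comap_mergeSuccessor (q : Fin (n + 2)) {s : Setoid (Fin (n + 1))}
    (hs : NonCrossing s) : NonCrossing (s.comap (mergeSuccessor q)) := by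
  induction q using Fin.lastCases with
  | last =>
    refine NonCrossing.of_rel_bot_top ?_ ?_
    · rw [Setoid.comap_rel, bot_eq_zero, Fin.top_eq_last, ← finRotate_last,
        mergeSuccessor_self_finRotate]
    · rw [← Setoid.comap_comp]
      have hval (x : Set.Iio (⊤ : Fin (n + 2))) : (mergeSuccessor (Fin.last (n + 1)) x : ℕ) = x :=
        val_mergeSuccessor_of_lt x.2
      exact hs.comap_monotone fun x y hxy => by simpa [Fin.le_def, hval] using hxy
  | cast q => exact hs.comap_monotone (monotone_mergeSuccessor_castSucc q)

theorem noRelSuccessor_comap_mergeSuccessor_iff {q : Fin (n + 2)} {j : ℕ} (hj : j ≤ q)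
    {s : Setoid (Fin (n + 1))} :
    NoRelSuccessor j (s.comap (mergeSuccessor q)) ↔ NoRelSuccessor j s := by
  constructor
  · intro h x hx
    have hxq : x.castSucc < q := hx.trans_le hj
    have hmerge : mergeSuccessor q x.castSucc = x := Fin.ext (val_mergeSuccessor_of_lt hxq)
    have hxs := h x.castSucc hx
    rwa [Setoid.comap_rel, mergeSuccessor_finRotate_of_lt hxq, hmerge] at hxs
  · intro h x hx
    have hxq : x < q := hx.trans_le hj
    rw [Setoid.comap_rel, mergeSuccessor_finRotate_of_lt hxq]
    exact h _ (val_mergeSuccessor_of_lt hxq ▸ hx)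

theorem rel_succAbove_mergeSuccessor {q : Fin (n + 2)} {r : Setoid (Fin (n + 2))}
    (hq : r q (finRotate (n + 2) q)) (x : Fin (n + 2)) :
    r x (q.succAbove (mergeSuccessor q x)) := by
  rcases Fin.eq_self_or_eq_succAbove q x with rfl | ⟨y, rfl⟩
  · have hne : finRotate (n + 2) x ≠ x := by simp
    obtain ⟨y, hy⟩ := Fin.exists_succAbove_eq hne
    rwa [← mergeSuccessor_self_finRotate, ← hy, mergeSuccessor_succAbove, hy]
  · rw [mergeSuccessor_succAbove]

theorem comap_mergeSuccessor_comap_succAbove {q : Fin (n + 2)} {r : Setoid (Fin (n + 2))}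
    (hq : r q (finRotate (n + 2) q)) :
    (r.comap q.succAbove).comap (mergeSuccessor q) = r := by
  have h := rel_succAbove_mergeSuccessor hq
  ext x y
  exact ⟨fun hxy => r.trans (h x) (r.trans hxy (r.symm (h y))),
    fun hxy => r.trans (r.symm (h x)) (r.trans hxy (h y))⟩

theorem bijOn_comap_mergeSuccessor {q : Fin (n + 2)} {j : ℕ} (hj : j ≤ q) :
    Set.BijOn (Setoid.comap (mergeSuccessor q))
      {s | NonCrossing s ∧ NoRelSuccessor j s}
      {r | (NonCrossing r ∧ NoRelSuccessor j r) ∧ r q (finRotate (n + 2) q)} := by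
  refine ⟨fun s hs => ⟨⟨nonCrossing_comap_mergeSuccessor q hs.1,
    (noRelSuccessor_comap_mergeSuccessor_iff hj).2 hs.2⟩, ?_⟩, ?_, ?_⟩
  · rw [Setoid.comap_rel, mergeSuccessor_self_finRotate]
  · exact (Setoid.comap_injective _
      (Function.RightInverse.surjective (mergeSuccessor_succAbove q))).injOn
  · rintro r ⟨⟨hr, hrj⟩, hrq⟩
    have hcomap := comap_mergeSuccessor_comap_succAbove hrq
    rw [← hcomap, noRelSuccessor_comap_mergeSuccessor_iff hj] at hrj
    exact ⟨_, ⟨hr.comap_monotone (Fin.strictMono_succAbove q).monotone, hrj⟩, hcomap⟩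

end MergeSuccessor

theorem nonCrossing_of_subsingleton {α : Type*} [Preorder α] [Subsingleton α] (r : Setoid α) :
    NonCrossing r :=
  fun i j _ _ hij => absurd hij (Subsingleton.elim i j ▸ lt_irrefl i)

instance subsingleton_setoid (α : Type*) [Subsingleton α] : Subsingleton (Setoid α) :=
  ⟨fun r s => Setoid.ext fun a b => Subsingleton.elim a b ▸ iff_of_true (r.refl a) (s.refl a)⟩

theorem ncard_rel_finRotate {n j : ℕ} {q : Fin (n + 1)} (hj : j ≤ q) :
    {r : Setoid (Fin (n + 1)) | (NonCrossing r ∧ NoRelSuccessor j r) ∧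
      r q (finRotate (n + 1) q)}.ncard = nonCrossingCount n j := by
  cases n with
  | zero =>
    obtain rfl : j = 0 := by lia
    simp [nonCrossingCount, nonCrossing_of_subsingleton, noRelSuccessor_zero]
  | succ n => exact (bijOn_comap_mergeSuccessor hj).ncard_eq.symm

theorem nonCrossingCount_succ_succ {n j : ℕ} (hj : j ≤ n) :
    (nonCrossingCount (n + 1) (j + 1) : ℤ) = nonCrossingCount (n + 1) j - nonCrossingCount n j := by
  let q : Fin (n + 1) := ⟨j, Nat.lt_succ_of_le hj⟩
  have hrel := ncard_rel_finRotate (q := q) le_rfl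
  have hnot : nonCrossingCount (n + 1) (j + 1) =
      {r : Setoid (Fin (n + 1)) | (NonCrossing r ∧ NoRelSuccessor j r) ∧
        ¬ r q (finRotate (n + 1) q)}.ncard := by
    simp only [nonCrossingCount, and_assoc]
    exact congrArg Set.ncard (Set.ext fun r => and_congr_right fun _ => noRelSuccessor_succ q r)
  rw [hnot, ← hrel, eq_sub_iff_add_eq', nonCrossingCount]
  exact_mod_cast Set.ncard_inter_add_ncard_sdiff_eq_ncard
    {r : Setoid (Fin (n + 1)) | NonCrossing r ∧ NoRelSuccessor j r}
    {r | r q (finRotate (n + 1) q)}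

section Append

variable {m n : ℕ}

theorem castAdd_lt_natAdd (x : Fin m) (y : Fin n) : Fin.castAdd n x < Fin.natAdd m y := by
  rw [Fin.lt_def, Fin.val_castAdd, Fin.val_natAdd]
  exact Nat.lt_add_right _ x.isLt

/-- The equivalence relation on `Fin (m + n)` that restricts to `s` on the first `m` elements, to
`t` on the last `n` elements, and relates nothing else. -/
def appendSetoid (s : Setoid (Fin m)) (t : Setoid (Fin n)) : Setoid (Fin (m + n)) :=
  Setoid.ker (Fin.append (Sum.inl ∘ Quotient.mk s) (Sum.inr ∘ Quotient.mk t))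

theorem appendSetoid_comap_castAdd (s : Setoid (Fin m)) (t : Setoid (Fin n)) :
    (appendSetoid s t).comap (Fin.castAdd n) = s := by
  ext x y
  rw [Setoid.comap_rel, appendSetoid, Setoid.ker_def]
  simp [Quotient.eq]

theorem appendSetoid_comap_natAdd (s : Setoid (Fin m)) (t : Setoid (Fin n)) :
    (appendSetoid s t).comap (Fin.natAdd m) = t := by
  ext x y
  rw [Setoid.comap_rel, appendSetoid, Setoid.ker_def]
  simp [Quotient.eq]

theorem not_appendSetoid_castAdd_natAdd (s : Setoid (Fin m)) (t : Setoid (Fin n))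
    (x : Fin m) (y : Fin n) : ¬ appendSetoid s t (Fin.castAdd n x) (Fin.natAdd m y) := by
  rw [appendSetoid, Setoid.ker_def]
  simp

theorem eq_of_comap_castAdd_eq_of_comap_natAdd_eq {r r' : Setoid (Fin (m + n))}
    (hr : ∀ x y, ¬ r (Fin.castAdd n x) (Fin.natAdd m y))
    (hr' : ∀ x y, ¬ r' (Fin.castAdd n x) (Fin.natAdd m y))
    (hleft : r.comap (Fin.castAdd n) = r'.comap (Fin.castAdd n))
    (hright : r.comap (Fin.natAdd m) = r'.comap (Fin.natAdd m)) : r = r' := by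
  ext x y
  induction x using Fin.addCases <;> induction y using Fin.addCases
  · exact Setoid.ext_iff.1 hleft _ _
  · exact iff_of_false (hr _ _) (hr' _ _)
  · exact iff_of_false (fun h => hr _ _ (r.symm h)) (fun h => hr' _ _ (r'.symm h))
  · exact Setoid.ext_iff.1 hright _ _

theorem nonCrossing_of_comap_castAdd_of_comap_natAdd {r : Setoid (Fin (m + n))}
    (hr : ∀ x y, ¬ r (Fin.castAdd n x) (Fin.natAdd m y))
    (hleft : NonCrossing (r.comap (Fin.castAdd n)))
    (hright : NonCrossing (r.comap (Fin.natAdd m))) : NonCrossing r := by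
  refine NonCrossing.of_comap_of_forall_lt (f := Fin.castAddOrderEmb n)
    (g := Fin.natAddOrderEmb m) (fun x y => ?_) (fun z => ?_) hr hleft hright
  · exact castAdd_lt_natAdd _ _
  · induction z using Fin.addCases with
    | left x => exact Or.inl ⟨x, rfl⟩
    | right y => exact Or.inr ⟨y, rfl⟩

theorem bijOn_comap_castAdd_comap_natAdd :
    Set.BijOn (fun r : Setoid (Fin (m + n)) => (r.comap (Fin.castAdd n), r.comap (Fin.natAdd m)))
      {r | NonCrossing r ∧ ∀ x y, ¬ r (Fin.castAdd n x) (Fin.natAdd m y)}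
      ({s | NonCrossing s} ×ˢ {t | NonCrossing t}) := by
  refine ⟨fun r hr => ⟨hr.1.comap_monotone (Fin.strictMono_castAdd n).monotone,
    hr.1.comap_monotone (Fin.strictMono_natAdd m).monotone⟩, ?_, ?_⟩
  · rintro r ⟨-, hr⟩ r' ⟨-, hr'⟩ h
    exact eq_of_comap_castAdd_eq_of_comap_natAdd_eq hr hr' (congrArg Prod.fst h)
      (congrArg Prod.snd h)
  · rintro ⟨s, t⟩ ⟨hs, ht⟩
    have hsep := not_appendSetoid_castAdd_natAdd s t
    have hleft := appendSetoid_comap_castAdd s t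
    have hright := appendSetoid_comap_natAdd s t
    refine ⟨appendSetoid s t, ⟨?_, hsep⟩, Prod.ext hleft hright⟩
    exact nonCrossing_of_comap_castAdd_of_comap_natAdd hsep (by rwa [hleft])
      (by rwa [hright])

end Append

section Catalan

theorem NonCrossing.isLeast_rel_last_iff {i j : ℕ} {r : Setoid (Fin (i + (j + 1)))}
    (hr : NonCrossing r) :
    IsLeast {x | r x (Fin.natAdd i (Fin.last j))} (Fin.natAdd i 0) ↔
      (∀ x y, ¬ r (Fin.castAdd (j + 1) x) (Fin.natAdd i y)) ∧
        r (Fin.natAdd i 0) (Fin.natAdd i (Fin.last j)) := by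
  constructor
  · rintro ⟨h0, hleast⟩
    have hnot (x : Fin i) : ¬ r (Fin.castAdd (j + 1) x) (Fin.natAdd i (Fin.last j)) :=
      fun h => (hleast h).not_gt (castAdd_lt_natAdd _ _)
    refine ⟨fun x y hxy => hnot x ?_, h0⟩
    rcases (Fin.zero_le y).eq_or_lt with rfl | hy0
    · exact r.trans hxy h0
    rcases (Fin.le_last y).eq_or_lt with rfl | hyl
    · exact hxy
    exact r.trans (hr (castAdd_lt_natAdd _ _) ((Fin.natAdd_lt_natAdd_iff _).2 hy0)
      ((Fin.natAdd_lt_natAdd_iff _).2 hyl) hxy h0) h0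
  · rintro ⟨hsep, h0⟩
    refine ⟨h0, fun z hz => ?_⟩
    induction z using Fin.addCases with
    | left x => exact absurd hz (hsep _ _)
    | right y => exact (Fin.natAdd_le_natAdd_iff _).2 (Fin.zero_le y)

theorem ncard_rel_zero_last (n : ℕ) :
    {r : Setoid (Fin (n + 1)) | NonCrossing r ∧ r 0 (Fin.last n)}.ncard =
      nonCrossingCount n 0 := by
  simpa only [noRelSuccessor_zero, and_true, finRotate_last, Setoid.comm'] using
    ncard_rel_finRotate (q := Fin.last n) (Nat.zero_le _)

theorem ncard_isLeast_rel_last (i j : ℕ) :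
    {r : Setoid (Fin (i + (j + 1))) | NonCrossing r ∧
      IsLeast {x | r x (Fin.natAdd i (Fin.last j))} (Fin.natAdd i 0)}.ncard =
      nonCrossingCount i 0 * nonCrossingCount j 0 := by
  have hbij := (bijOn_comap_castAdd_comap_natAdd (m := i) (n := j + 1)).subset_right
    (r := {s | NonCrossing s} ×ˢ {t | NonCrossing t ∧ t 0 (Fin.last j)})
    (Set.prod_mono_right fun _ => And.left)
  rw [← ncard_nonCrossing i, ← ncard_rel_zero_last, ← Set.ncard_prod, ← hbij.ncard_eq]
  congr 1
  ext r
  constructor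
  · rintro ⟨hr, hleast⟩
    obtain ⟨hsep, h0⟩ := hr.isLeast_rel_last_iff.1 hleast
    have hmaps := bijOn_comap_castAdd_comap_natAdd.mapsTo ⟨hr, hsep⟩
    exact ⟨⟨hr, hsep⟩, hmaps.1, hmaps.2, h0⟩
  · rintro ⟨⟨hr, hsep⟩, -, -, h0⟩
    exact ⟨hr, hr.isLeast_rel_last_iff.2 ⟨hsep, h0⟩⟩

theorem nonCrossingCount_zero_zero : nonCrossingCount 0 0 = 1 := by
  simp [← ncard_nonCrossing, nonCrossing_of_subsingleton]

theorem nonCrossingCount_succ_zero (n : ℕ) : nonCrossingCount (n + 1) 0 =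
    ∑ i : Fin (n + 1), nonCrossingCount i 0 * nonCrossingCount (n - i) 0 := by
  let fiber (i : Fin (n + 1)) : Set (Setoid (Fin (n + 1))) :=
    {r | NonCrossing r ∧ IsLeast {x | r x (Fin.last n)} i}
  have hcover : {r : Setoid (Fin (n + 1)) | NonCrossing r} = ⋃ i, fiber i := by
    ext r
    have hleast : ∃ i, IsLeast {x | r x (Fin.last n)} i :=
      ⟨_, isLeast_csInf ⟨_, r.refl _⟩⟩
    simp [fiber, hleast]
  have hdisj : Pairwise (Function.onFun Disjoint fiber) := fun i i' hii' =>
    Set.disjoint_left.2 fun r hr hr' => hii' (hr.2.unique hr'.2)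
  rw [← ncard_nonCrossing, hcover, Set.ncard_iUnion_of_finite (fun _ => Set.toFinite _) hdisj,
    finsum_eq_sum_of_fintype]
  refine sum_congr rfl fun ⟨i, hi⟩ _ => ?_
  obtain ⟨j, rfl⟩ := Nat.exists_eq_add_of_le (Nat.le_of_lt_succ hi)
  rw [Nat.add_sub_cancel_left]
  exact ncard_isLeast_rel_last i j

theorem nonCrossingCount_eq_catalan (n : ℕ) : nonCrossingCount n 0 = catalan n := by
  induction n using Nat.strong_induction_on with
  | _ n ih =>
  cases n with
  | zero => rw [nonCrossingCount_zero_zero, catalan_zero]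
  | succ n =>
    rw [nonCrossingCount_succ_zero, catalan_succ]
    exact sum_congr rfl fun i _ => by rw [ih i i.isLt, ih (n - i) (by lia)]

end Catalan

section ForwardDifference

theorem fwdDiff_iter_eq_sum_shift_reflect {M G : Type*} [AddCommMonoid M] [AddCommGroup G] (h : M)
    (f : M → G) (n : ℕ) (y : M) : (fwdDiff h)^[n] f y =
      ∑ k ∈ range (n + 1), ((-1 : ℤ) ^ k * n.choose k) • f (y + (n - k) • h) := by
  rw [fwdDiff_iter_eq_sum_shift, ← sum_range_reflect]
  refine sum_congr rfl fun k hk => ?_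
  have hk : k ≤ n := mem_range_succ_iff.1 hk
  rw [Nat.add_sub_cancel, Nat.sub_sub_self hk, Nat.choose_symm hk]

theorem nonCrossingCount_add_eq_fwdDiff_iter (m j : ℕ) :
    (nonCrossingCount (m + j) j : ℤ) = (fwdDiff 1)^[j] (fun n => (catalan n : ℤ)) m := by
  induction j generalizing m with
  | zero => simp [nonCrossingCount_eq_catalan]
  | succ j ih =>
    rw [Function.iterate_succ_apply', fwdDiff, ← ih, ← ih, ← add_assoc,
      nonCrossingCount_succ_succ (Nat.le_add_left j m), add_right_comm]

theorem catalanDifference_eq_fwdDiff_iter (n : ℕ) :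
    catalanDifference n = (fwdDiff 1)^[n] (fun n => (catalan n : ℤ)) 0 := by
  simp [catalanDifference, fwdDiff_iter_eq_sum_shift]

end ForwardDifference

theorem noEqualCyclicallyAdjacent_iff {n : ℕ} {w : Fin n → ℕ} :
    NoEqualCyclicallyAdjacent w ↔ NoEqualSuccessorAmongFirst n w := by
  simp [NoEqualCyclicallyAdjacent, NoEqualSuccessorAmongFirst]

theorem mainTheorem4 :
    (∀ n : ℕ,
      (Nat.card {P : Finpartition (univ : Finset (Fin n)) //
        IsNonCrossing P ∧ NoEqualCyclicallyAdjacent (canonicalWord P)} : ℤ) =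
        catalanDifference n) ∧
    (∀ n j : ℕ, j ≤ n →
      (Nat.card {P : Finpartition (univ : Finset (Fin n)) //
        IsNonCrossing P ∧ NoEqualSuccessorAmongFirst j (canonicalWord P)} : ℤ) =
        ∑ i ∈ range (j + 1), (-1 : ℤ) ^ i * (j.choose i : ℤ) * (catalan (n - i) : ℤ)) := by
  simp only [noEqualCyclicallyAdjacent_iff, card_isNonCrossing_noEqualSuccessorAmongFirst]
  constructor
  · intro n
    rw [catalanDifference_eq_fwdDiff_iter, ← nonCrossingCount_add_eq_fwdDiff_iter, zero_add]
  · intro n j hj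
    obtain ⟨m, rfl⟩ := Nat.exists_eq_add_of_le' hj
    rw [nonCrossingCount_add_eq_fwdDiff_iter, fwdDiff_iter_eq_sum_shift_reflect]
    refine sum_congr rfl fun i hi => ?_
    rw [smul_eq_mul, smul_eq_mul, mul_one, Nat.add_sub_assoc (mem_range_succ_iff.1 hi)]
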